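/- Let $E,A\in\mathbb{C}^{n\times n}$, $B\in\mathbb{C}^{n\times m}$, $C\in\mathbb{C}^{m\times n}$. The descriptor system $E\dot x=Ax+Bu$, $y=Cx$ is called \emph{port-Hamiltonian (pH) with structure matrix} $Q\in\mathbb{C}^{n\times n}$ if there are $J,R\in\mathbb{C}^{n\times n}$ and $G,P\in\mathbb{C}^{n\times m}$ with $A=(J-R)Q$, $B=G-P$, $C=(G+P)^*Q$ and $$Q^*E=E^*Q\ge 0,\qquad Q^*JQ=-(Q^*JQ)^*,\qquad Q^*RQ\ge 0,\qquad Q^*P=0,$$ where $M\ge 0$ means that $M$ is Hermitian positive semidefinite; it is called \emph{pH} if it is pH with some structure matrix $Q$. A pair $(E,A)$ is \emph{regular} if $\det(sE-A)\ne 0$ for some $s\in\mathbb{C}$, \emph{impulse-free} if $\deg\det(sE-A)=\operatorname{rank}E$, and \emph{asymptotically stable} if every $s\in\mathbb{C}$ with $\det(sE-A)=0$ satisfies $\Re(s)<0$. For a matrix $M$, let $S_\infty(M)$ (respectively $T_\infty(M)$) denote any matrix whose columns form an orthonormal basis of the right nullspace $\{x: Mx=0\}$ (respectively the left nullspace $\{y: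 y^*M=0\}$), and put $$T_a=T_\infty\big(E\,S_\infty(C)\big),\qquad S_b=S_\infty\left(\begin{bmatrix}E\\ \big(T_\infty([E\ \ B])\big)^*A\\ C\end{bmatrix}\right).$$ \textbf{Theorem.} Let the system $E\dot x=Ax+Bu$, $y=Cx$ be pH and let $r$ be an integer. For every choice of the orthonormal nullspace bases in $T_a$ and $S_b$, there exist $K,F\in\mathbb{C}^{m\times m}$ such that the pair $(E+BFC,\,A-BKC)$ is regular, impulse-free and asymptotically stable, $\operatorname{rank}(E+BFC)=r$, and the closed-loop system $(E+BFC)\dot x=(A-BKC)x+Bv$, $y=Cx$ is pH, if and only if the following three conditions hold: (i) $T_a^*AS_b$ has full column rank; (ii) for all $s\in\mathbb{C}$ with $\Re(s)=0$, $$\operatorname{rank}\begin{bmatrix}sE-A & B\end{bmatrix}=\operatorname{rank}\begin{bmatrix}sE-A\\ C\end{bmatrix}=n;$$ (iii) $\operatorname{rank}[E\ \ B]-\operatorname{rank}B\ \le\ r\ \le\ \operatorname{rank}[E\ \ B]-\operatorname{rank}(T_a^*AS_b)$. The same equivalence holds if, for any $Q$ with which the given system is pH, the closed-loop system is required to be pH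 with that same structure matrix $Q$. -/

import Mathlib

open scoped Matrix ComplexOrder

namespace DescriptorSystem

/-- The finite generalized eigenvalues of the pair `(E, A)`. -/
def finiteSpectrum {n : ℕ} (E A : Matrix (Fin n) (Fin n) ℂ) : Set ℂ :=
  {s : ℂ | (s • E - A).det = 0}

/-- The polynomial `det (s E - A)` in the indeterminate `s`. -/
noncomputable def charPoly {n : ℕ} (E A : Matrix (Fin n) (Fin n) ℂ) : Polynomial ℂ :=
  ((Polynomial.X : Polynomial ℂ) • E.map Polynomial.C - A.map Polynomial.C).det

/-- The pair `(E, A)` is regular: `det (s E - A) ≠ 0` for some scalar `s`. -/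
def IsRegular {n : ℕ} (E A : Matrix (Fin n) (Fin n) ℂ) : Prop :=
  ∃ s : ℂ, (s • E - A).det ≠ 0

/-- The pair `(E, A)` is impulse-free: `deg (det (s E - A)) = rank E`.
The zero polynomial has degree `⊥`, so an impulse-free pair is regular. -/
def IsImpulseFree {n : ℕ} (E A : Matrix (Fin n) (Fin n) ℂ) : Prop :=
  (charPoly E A).degree = (E.rank : WithBot ℕ)

/-- The pair `(E, A)` is asymptotically stable: all finite eigenvalues lie in the open left
half plane. -/
def IsAsymptoticallyStable {n : ℕ} (E A : Matrix (Fin n) (Fin n) ℂ) : Prop :=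
  finiteSpectrum E A ⊆ {s : ℂ | s.re < 0}

/-- The system `E x' = A x + B u`, `y = C x` is port-Hamiltonian with structure matrix `Q`.
`Matrix.PosSemidef` includes being Hermitian. -/
def IsPortHamiltonianWith {n m : ℕ} (Q E A : Matrix (Fin n) (Fin n) ℂ)
    (B : Matrix (Fin n) (Fin m) ℂ) (C : Matrix (Fin m) (Fin n) ℂ) : Prop :=
  ∃ (J R : Matrix (Fin n) (Fin n) ℂ) (G P : Matrix (Fin n) (Fin m) ℂ),
    A = (J - R) * Q ∧ B = G - P ∧ C = (G + P)ᴴ * Q ∧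
    Qᴴ * E = Eᴴ * Q ∧ (Qᴴ * E).PosSemidef ∧
    Qᴴ * J * Q = -(Qᴴ * J * Q)ᴴ ∧ (Qᴴ * R * Q).PosSemidef ∧ Qᴴ * P = 0

/-- The system `E x' = A x + B u`, `y = C x` is port-Hamiltonian. -/
def IsPortHamiltonian {n m : ℕ} (E A : Matrix (Fin n) (Fin n) ℂ)
    (B : Matrix (Fin n) (Fin m) ℂ) (C : Matrix (Fin m) (Fin n) ℂ) : Prop :=
  ∃ Q : Matrix (Fin n) (Fin n) ℂ, IsPortHamiltonianWith Q E A B C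

/-- The columns of `S` are orthonormal and span the right nullspace `{x | M x = 0}` of `M`. -/
def IsRightNullBasis {p q : Type*} [Fintype p] [Fintype q] {k : ℕ}
    (M : Matrix p q ℂ) (S : Matrix q (Fin k) ℂ) : Prop :=
  Sᴴ * S = 1 ∧ ∀ x : q → ℂ, M *ᵥ x = 0 ↔ ∃ c : Fin k → ℂ, x = S *ᵥ c

/-- The columns of `T` are orthonormal and span the left nullspace `{y | y* M = 0}` of `M`. -/
def IsLeftNullBasis {p q : Type*} [Fintype p] [Fintype q] {k : ℕ}
    (M : Matrix p q ℂ) (T : Matrix p (Fin k) ℂ) : Prop :=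
  Tᴴ * T = 1 ∧ ∀ y : p → ℂ, star y ᵥ* M = 0 ↔ ∃ c : Fin k → ℂ, y = T *ᵥ c

/-- `T_a` spans the left nullspace of `E S`, where `S` spans the right nullspace of `C`. -/
def IsTa {n m k : ℕ} (E : Matrix (Fin n) (Fin n) ℂ) (C : Matrix (Fin m) (Fin n) ℂ)
    (Ta : Matrix (Fin n) (Fin k) ℂ) : Prop :=
  ∃ (l : ℕ) (S : Matrix (Fin n) (Fin l) ℂ), IsRightNullBasis C S ∧ IsLeftNullBasis (E * S) Ta

/-- `S_b` spans the right nullspace of `[E; T* A; C]`, where `T` spans the left nullspace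
of `[E B]`. -/
def IsSb {n m k : ℕ} (E A : Matrix (Fin n) (Fin n) ℂ)
    (B : Matrix (Fin n) (Fin m) ℂ) (C : Matrix (Fin m) (Fin n) ℂ)
    (Sb : Matrix (Fin n) (Fin k) ℂ) : Prop :=
  ∃ (l : ℕ) (T : Matrix (Fin n) (Fin l) ℂ), IsLeftNullBasis (Matrix.fromCols E B) T ∧
    IsRightNullBasis (Matrix.fromRows E (Matrix.fromRows (Tᴴ * A) C)) Sb

/-- The three solvability conditions, for given matrices `T_a` and `S_b`. -/
def SolvabilityConditions {n m k l : ℕ} (E A : Matrix (Fin n) (Fin n) ℂ)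
    (B : Matrix (Fin n) (Fin m) ℂ) (C : Matrix (Fin m) (Fin n) ℂ)
    (Ta : Matrix (Fin n) (Fin k) ℂ) (Sb : Matrix (Fin n) (Fin l) ℂ) (r : ℤ) : Prop :=
  (Taᴴ * A * Sb).rank = l ∧
  (∀ s : ℂ, s.re = 0 →
    (Matrix.fromCols (s • E - A) B).rank = n ∧ (Matrix.fromRows (s • E - A) C).rank = n) ∧
  ((Matrix.fromCols E B).rank : ℤ) - (B.rank : ℤ) ≤ r ∧
  r ≤ ((Matrix.fromCols E B).rank : ℤ) - ((Taᴴ * A * Sb).rank : ℤ)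

end DescriptorSystem

namespace DescriptorSystem

/-! ### Linear algebra: ranges, ranks and generalized inverses. -/

section LinearAlgebra

variable {p q q' : Type*} [Fintype q] [Fintype q']

/-! Output feedback changes nothing on ker C and nothing modulo range B.

Necessity (`solvabilityConditions_of_feedback`). Stability excludes s = 0, so the closed-loop A' = A
- BKC is invertible. Impulse-freeness of (E', A'), with E' = E + BFC, then means that E'x = 0 and
A'x = E'z force x = 0 (`isImpulseFree_iff`). Restricting x and z to ker C, where feedback is
invisible, gives (i). Invertibility of sE' - A' on the imaginary axis gives (ii). The lower bound in
(iii) comes from range E' + range B = range E + range B. For the upper bound, A maps range Sb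
injectively into this space, and impulse-freeness makes the image disjoint from range E'.

Sufficiency (`exists_feedback`). By (ii) at s = 0 the structure matrix Q is invertible. Multiplying
by Qᴴ turns E into M = QᴴE ≥ 0 and B into Cᴴ, so E' becomes M + CᴴFC. The choice K = 1 adds
dissipation ‖Cx‖², which forces Cx = 0 for every eigenvector with Re s ≥ 0 and every x that violates
impulse-freeness. Condition (ii) rules out the former. The latter disappear once range(M + CᴴFC)
meets L = range(QᴴA Sb) trivially. The core is to find F with this property, with M + CᴴFC ≥ 0 and
rank r (`exists_posSemidef_rank_eq`): first shrink the range to M(ker C), which (i) makes disjoint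
from L, then enlarge it by suitable directions in range Cᴴ. -/

/-- Fredholm alternative: a functional separating w from the range of M is, read as a row vector, a
left null vector of M. -/
theorem mem_range_of_forall_left_null [Fintype p] (M : Matrix p q ℂ) (w : p → ℂ)
    (h : ∀ y : p → ℂ, star y ᵥ* M = 0 → star y ⬝ᵥ w = 0) :
    ∃ z, M *ᵥ z = w := by
  classical
  by_contra hw
  have hw' : w ∉ LinearMap.range M.mulVecLin := fun ⟨z, hz⟩ => hw ⟨z, by simpa using hz⟩
  obtain ⟨f, hf, hmap⟩ := Submodule.exists_dual_map_eq_bot_of_notMem hw' inferInstance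
  have hfd : ∀ x, f x = (fun i => f (Pi.single i 1)) ⬝ᵥ x := by
    intro x
    rw [LinearMap.pi_apply_eq_sum_univ f x]
    simp only [dotProduct, smul_eq_mul, ← Pi.single_apply]
    refine Finset.sum_congr rfl fun i _ => ?_
    rw [mul_comm]
    congr 2
    ext j
    simp [Pi.single_apply, eq_comm]
  refine hf ?_
  rw [hfd]
  have := h (star fun i => f (Pi.single i 1)) ?_
  · simpa using this
  rw [star_star]
  refine dotProduct_eq_zero _ fun x => ?_
  rw [← Matrix.dotProduct_mulVec, ← hfd]
  have : f (M.mulVecLin x) ∈ (LinearMap.range M.mulVecLin).map f := ⟨_, ⟨x, rfl⟩, rfl⟩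
  rw [hmap] at this
  simpa using this

theorem IsLeftNullBasis.conjTranspose_mulVec_eq_zero_iff [Fintype p] {k : ℕ} {M : Matrix p q ℂ}
    {T : Matrix p (Fin k) ℂ} (hT : IsLeftNullBasis M T) (w : p → ℂ) :
    Tᴴ *ᵥ w = 0 ↔ ∃ z, M *ᵥ z = w := by
  constructor
  · intro h
    refine mem_range_of_forall_left_null M w fun y hy => ?_
    obtain ⟨c, rfl⟩ := (hT.2 y).1 hy
    rw [Matrix.star_mulVec, ← Matrix.dotProduct_mulVec, h, dotProduct_zero]
  · rintro ⟨z, rfl⟩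
    refine dotProduct_star_self_eq_zero.1 ?_
    -- Testing against the left null vector T Tᴴ M z yields ‖TᴴMz‖² = 0.
    have h := (hT.2 (T *ᵥ (Tᴴ *ᵥ (M *ᵥ z)))).2 ⟨_, rfl⟩
    rw [Matrix.star_mulVec] at h
    rw [Matrix.dotProduct_mulVec, Matrix.dotProduct_mulVec, h]
    simp

theorem range_fromCols (A : Matrix p q ℂ) (B : Matrix p q' ℂ) :
    LinearMap.range (Matrix.fromCols A B).mulVecLin =
      LinearMap.range A.mulVecLin ⊔ LinearMap.range B.mulVecLin := by
  ext x
  simp only [LinearMap.mem_range, Submodule.mem_sup, Matrix.mulVecLin_apply]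
  constructor
  · rintro ⟨v, rfl⟩
    exact ⟨_, ⟨_, rfl⟩, _, ⟨_, rfl⟩, (Matrix.fromCols_mulVec A B v).symm⟩
  · rintro ⟨_, ⟨u, rfl⟩, _, ⟨v, rfl⟩, rfl⟩
    exact ⟨Sum.elim u v, by rw [Matrix.fromCols_mulVec_sumElim]⟩

theorem rank_fromCols (A : Matrix p q ℂ) (B : Matrix p q' ℂ) :
    (Matrix.fromCols A B).rank =
      Module.finrank ℂ ↥(LinearMap.range A.mulVecLin ⊔ LinearMap.range B.mulVecLin) := by
  rw [Matrix.rank, range_fromCols]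

theorem rank_eq_card_iff (A : Matrix p q ℂ) :
    A.rank = Fintype.card q ↔ ∀ x, A *ᵥ x = 0 → x = 0 := by
  have h := LinearMap.finrank_range_add_finrank_ker A.mulVecLin
  rw [Module.finrank_fintype_fun_eq_card] at h
  have : (∀ x, A *ᵥ x = 0 → x = 0) ↔ Module.finrank ℂ (LinearMap.ker A.mulVecLin) = 0 := by
    rw [Submodule.finrank_eq_zero, LinearMap.ker_eq_bot']
    rfl
  rw [this, Matrix.rank]
  omega

theorem exists_generalized_inverse [Fintype p] [DecidableEq p] [DecidableEq q] (M : Matrix p q ℂ) :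
    ∃ G : Matrix q p ℂ, M * G * M = M := by
  obtain ⟨g, hg⟩ := M.mulVecLin.rangeRestrict.exists_rightInverse_of_surjective
    M.mulVecLin.range_rangeRestrict
  obtain ⟨g', hg'⟩ := LinearMap.exists_extend g
  refine ⟨LinearMap.toMatrix' g', ?_⟩
  refine Matrix.ext_of_mulVec_single fun j => ?_
  generalize (Pi.single j 1 : q → ℂ) = x
  rw [← Matrix.mulVec_mulVec, ← Matrix.mulVec_mulVec, LinearMap.toMatrix'_mulVec]
  have h1 := LinearMap.congr_fun hg' ⟨M *ᵥ x, ⟨x, rfl⟩⟩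
  have h2 := congrArg Subtype.val (LinearMap.congr_fun hg ⟨M *ᵥ x, ⟨x, rfl⟩⟩)
  simp only [LinearMap.comp_apply, Submodule.subtype_apply] at h1 h2
  rw [h1]
  exact h2

theorem mul_eq_self_of_ker_le [Fintype p] {q'' : Type*} [Fintype q''] [DecidableEq q]
    {C : Matrix p q ℂ} {G : Matrix q p ℂ} (hG : C * G * C = C) {D : Matrix q'' q ℂ}
    (hD : ∀ x, C *ᵥ x = 0 → D *ᵥ x = 0) : D * (G * C) = D := by
  refine Matrix.ext_of_mulVec_single fun j => ?_
  generalize (Pi.single j 1 : q → ℂ) = x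
  have := hD (x - (G * C) *ᵥ x) (by
    rw [Matrix.mulVec_sub, Matrix.mulVec_mulVec, ← Matrix.mul_assoc, hG, sub_self])
  rw [Matrix.mulVec_sub, sub_eq_zero, Matrix.mulVec_mulVec] at this
  exact this.symm

/-- For positive semidefinite matrices ker(A + B) = ker A ∩ ker B, because both quadratic forms must
vanish; ranges follow by taking orthogonal complements. -/
theorem range_add_of_posSemidef [Fintype p] {A B : Matrix p p ℂ} (hA : A.PosSemidef)
    (hB : B.PosSemidef) :
    LinearMap.range (A + B).mulVecLin =
      LinearMap.range A.mulVecLin ⊔ LinearMap.range B.mulVecLin := by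
  have key : ∀ y : p → ℂ, star y ᵥ* (A + B) = 0 → A *ᵥ y = 0 ∧ B *ᵥ y = 0 := by
    intro y hy
    have h : star y ⬝ᵥ A *ᵥ y + star y ⬝ᵥ B *ᵥ y = 0 := by
      rw [← dotProduct_add, ← Matrix.add_mulVec, Matrix.dotProduct_mulVec, hy, zero_dotProduct]
    have h' := (add_eq_zero_iff_of_nonneg (hA.dotProduct_mulVec_nonneg y)
      (hB.dotProduct_mulVec_nonneg y)).1 h
    exact ⟨(hA.dotProduct_mulVec_zero_iff y).1 h'.1, (hB.dotProduct_mulVec_zero_iff y).1 h'.2⟩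
  have aux : ∀ H : Matrix p p ℂ, H.PosSemidef → ∀ y, H *ᵥ y = 0 → ∀ u, star y ⬝ᵥ H *ᵥ u = 0 := by
    intro H hH y hy u
    rw [Matrix.dotProduct_mulVec, ← hH.1, ← Matrix.star_mulVec, hy, star_zero, zero_dotProduct]
  apply le_antisymm
  · rintro _ ⟨x, rfl⟩
    rw [Matrix.mulVecLin_apply, Matrix.add_mulVec]
    exact Submodule.add_mem_sup ⟨x, rfl⟩ ⟨x, rfl⟩
  · refine sup_le ?_ ?_
    · rintro _ ⟨u, rfl⟩
      obtain ⟨z, hz⟩ := mem_range_of_forall_left_null (A + B) (A *ᵥ u)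
        fun y hy => aux A hA y (key y hy).1 u
      exact ⟨z, hz⟩
    · rintro _ ⟨u, rfl⟩
      obtain ⟨z, hz⟩ := mem_range_of_forall_left_null (A + B) (B *ᵥ u)
        fun y hy => aux B hB y (key y hy).2 u
      exact ⟨z, hz⟩

theorem exists_le_finrank_eq {V : Type*} [AddCommGroup V] [Module ℂ V] [FiniteDimensional ℂ V]
    (U : Submodule ℂ V) {d : ℕ} (hd : d ≤ Module.finrank ℂ U) :
    ∃ T ≤ U, Module.finrank ℂ T = d := by
  let b := Module.finBasis ℂ U
  let v : Fin d → V := fun i => (b (Fin.castLE hd i) : V)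
  have hv : LinearIndependent ℂ v :=
    (b.linearIndependent.map' U.subtype (Submodule.ker_subtype U)).comp _
      (Fin.castLE_injective hd)
  refine ⟨Submodule.span ℂ (Set.range v), ?_, ?_⟩
  · rw [Submodule.span_le]
    rintro _ ⟨i, rfl⟩
    exact (b (Fin.castLE hd i)).2
  · rw [finrank_span_eq_card hv, Fintype.card_fin]

theorem exists_matrix_range_eq [Fintype p] [DecidableEq p] (T : Submodule ℂ (p → ℂ)) :
    ∃ Y : Matrix p p ℂ, LinearMap.range Y.mulVecLin = T := by
  obtain ⟨g, hg⟩ := LinearMap.exists_extend (LinearMap.id : T →ₗ[ℂ] T)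
  refine ⟨LinearMap.toMatrix' (T.subtype ∘ₗ g), ?_⟩
  have : (LinearMap.toMatrix' (T.subtype ∘ₗ g)).mulVecLin = T.subtype ∘ₗ g :=
    Matrix.toLin'_toMatrix' _
  rw [this, LinearMap.range_comp, LinearMap.range_eq_top.2, Submodule.map_top,
    Submodule.range_subtype]
  exact fun t => ⟨t, LinearMap.congr_fun hg t⟩

end LinearAlgebra

/-! ### Impulse-freeness as absence of Jordan chains at infinity. -/

/-- With M = A⁻¹E, det(sE - A) is det(-A) times the reversed characteristic polynomial of M, so its
degree is n minus the algebraic multiplicity of the eigenvalue 0 of M. Since rank E = n - dim ker M,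
impulse-freeness says that 0 is semisimple, i.e. M has no Jordan chain of length two at 0. -/
theorem isImpulseFree_iff {n : ℕ} {E A : Matrix (Fin n) (Fin n) ℂ} (hA : IsUnit A.det) :
    IsImpulseFree E A ↔ ∀ x z, E *ᵥ x = 0 → A *ᵥ x = E *ᵥ z → x = 0 := by
  set M := A⁻¹ * E with hM
  have hAM : A * M = E := by rw [hM, ← Matrix.mul_assoc, Matrix.mul_nonsing_inv A hA, one_mul]
  have hchar : charPoly E A = Polynomial.C ((-A).det) * M.charpolyRev := by
    have h1 : Polynomial.C ((-A).det) = (-(A.map Polynomial.C)).det := by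
      rw [RingHom.map_det]; congr 1; ext i j; simp
    rw [h1, Matrix.charpolyRev, ← Matrix.det_mul, charPoly]
    congr 1
    rw [Matrix.mul_sub, mul_one, Matrix.mul_smul, neg_mul, ← Matrix.map_mul, hAM]
    simp [sub_eq_add_neg, add_comm]
  have hdet : (-A).det ≠ 0 := by
    rw [Matrix.det_neg]
    exact mul_ne_zero (pow_ne_zero _ (by norm_num)) hA.ne_zero
  have hrev : M.charpolyRev ≠ 0 := by
    intro h
    have := M.eval_charpolyRev
    simp [h] at this
  have hrank : E.rank = M.rank := by
    rw [← hAM, Matrix.rank_mul_eq_right_of_isUnit_det _ _ hA]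
  have hdeg : IsImpulseFree E A ↔
      Module.finrank ℂ (Module.End.maxGenEigenspace M.mulVecLin 0) =
        Module.finrank ℂ (LinearMap.ker M.mulVecLin) := by
    rw [IsImpulseFree, hchar, Polynomial.degree_C_mul hdet, Polynomial.degree_eq_natDegree hrev,
      hrank, Nat.cast_inj, ← Matrix.reverse_charpoly, Polynomial.reverse_natDegree,
      LinearMap.finrank_maxGenEigenspace_zero_eq, Matrix.charpoly_mulVecLin,
      Matrix.charpoly_natDegree_eq_dim]
    have h1 := LinearMap.finrank_range_add_finrank_ker M.mulVecLin
    have h2 := M.charpoly.natTrailingDegree_le_natDegree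
    rw [Matrix.charpoly_natDegree_eq_dim] at h2
    rw [Module.finrank_fintype_fun_eq_card] at h1
    rw [Matrix.rank]
    omega
  have hle : LinearMap.ker M.mulVecLin ≤ Module.End.maxGenEigenspace M.mulVecLin 0 := by
    intro x hx
    rw [Module.End.mem_maxGenEigenspace]
    exact ⟨1, by simpa using hx⟩
  have hE : ∀ x, E *ᵥ x = 0 ↔ M *ᵥ x = 0 := by
    intro x
    constructor
    · intro h
      rw [hM, ← Matrix.mulVec_mulVec, h, Matrix.mulVec_zero]
    · intro h
      rw [← hAM, ← Matrix.mulVec_mulVec, h, Matrix.mulVec_zero]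
  rw [hdeg]
  constructor
  · intro h x z hx hz
    have heq := Submodule.eq_of_le_of_finrank_eq hle h.symm
    have hxz : x = M *ᵥ z := by
      rw [hM, ← Matrix.mulVec_mulVec, ← hz, Matrix.mulVec_mulVec, Matrix.nonsing_inv_mul A hA,
        Matrix.one_mulVec]
    have hz' : z ∈ LinearMap.ker M.mulVecLin := by
      rw [heq, Module.End.mem_maxGenEigenspace]
      refine ⟨2, ?_⟩
      rw [hE, hxz] at hx
      simpa [pow_two] using hx
    rw [hxz]
    exact hz'
  · intro h
    have : Module.End.maxGenEigenspace M.mulVecLin 0 = LinearMap.ker M.mulVecLin := by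
      refine le_antisymm (fun x hx => ?_) hle
      rw [Module.End.mem_maxGenEigenspace] at hx
      obtain ⟨k, hk⟩ := hx
      rw [zero_smul, sub_zero] at hk
      induction k generalizing x with
      | zero =>
        have : x = 0 := by simpa using hk
        rw [this]; exact Submodule.zero_mem _
      | succ k ih =>
        rw [pow_succ, Module.End.mul_apply] at hk
        have h1 : M *ᵥ (M *ᵥ x) = 0 := ih _ hk
        -- The hypothesis is applied to the pair (Mx, x), as A(Mx) = Ex.
        refine h _ x ((hE _).2 h1) ?_
        rw [Matrix.mulVecLin_apply, Matrix.mulVec_mulVec, hAM]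
    rw [this]

/-! ### Shaping the range of M + CᴴFC. -/

section OutputInjection

variable {p q : Type*} [Fintype p] [Fintype q] [DecidableEq p] [DecidableEq q]

/-- The target is D = MS(SᴴMS)⁺SᴴM, where S projects onto ker C and ⁺ is a positive semidefinite
generalized inverse. It agrees with M on ker C, so the Hermitian matrix D - M vanishes there and has
the form CᴴFC. -/
theorem exists_posSemidef_range_eq_map_ker {M : Matrix q q ℂ} (hM : M.PosSemidef)
    (C : Matrix p q ℂ) :
    ∃ F : Matrix p p ℂ, (M + Cᴴ * F * C).PosSemidef ∧
      LinearMap.range (M + Cᴴ * F * C).mulVecLin =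
        (LinearMap.ker C.mulVecLin).map M.mulVecLin := by
  obtain ⟨G, hG⟩ := exists_generalized_inverse C
  set S : Matrix q q ℂ := 1 - G * C with hS
  have hCS : C * S = 0 := by rw [hS, Matrix.mul_sub, Matrix.mul_one, ← Matrix.mul_assoc, hG, sub_self]
  have hSx : ∀ x, C *ᵥ x = 0 → S *ᵥ x = x := by
    intro x hx
    rw [hS, Matrix.sub_mulVec, Matrix.one_mulVec, ← Matrix.mulVec_mulVec, hx, Matrix.mulVec_zero,
      sub_zero]
  obtain ⟨N, hN⟩ : ∃ N, N = Sᴴ * M * S := ⟨_, rfl⟩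
  have hNp : N.PosSemidef := hN ▸ hM.conjTranspose_mul_mul_same S
  obtain ⟨X, hX⟩ := exists_generalized_inverse N
  have hX' : N * Xᴴ * N = N := by
    have := congrArg Matrix.conjTranspose hX
    rwa [Matrix.conjTranspose_mul, Matrix.conjTranspose_mul, hNp.1, ← Matrix.mul_assoc] at this
  -- Symmetrizing X gives a generalized inverse of N that is itself positive semidefinite.
  set Y := Xᴴ * N * X with hY
  have hYp : Y.PosSemidef := hNp.conjTranspose_mul_mul_same X
  have hNY : N * Y * N = N := by
    calc N * Y * N = (N * Xᴴ * N) * X * N := by rw [hY]; simp only [Matrix.mul_assoc]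
      _ = N := by rw [hX', hX]
  set D := M * S * Y * Sᴴ * M with hD
  have hDp : D.PosSemidef := by
    have := hYp.mul_mul_conjTranspose_same (M * S)
    rwa [Matrix.conjTranspose_mul, hM.1, ← Matrix.mul_assoc] at this
  -- The defect is MT with SᴴMT = 0; hence TᴴMT = 0, and M ≥ 0 gives MT = 0.
  have hDS : D * S = M * S := by
    obtain ⟨T, hT⟩ : ∃ T, T = S * (Y * N - 1) := ⟨_, rfl⟩
    have h1 : D * S - M * S = M * T := by
      rw [hT, hD, hN]; simp only [Matrix.mul_sub, Matrix.mul_assoc, mul_one]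
    have h2 : Tᴴ * M * T = 0 := by
      have : Sᴴ * M * T = 0 := by
        calc Sᴴ * M * T = N * Y * N - N := by
              rw [hT, hN]; simp only [Matrix.mul_sub, Matrix.mul_assoc, mul_one]
          _ = 0 := by rw [hNY, sub_self]
      have hT' : Tᴴ = (Y * N - 1)ᴴ * Sᴴ := by rw [hT, Matrix.conjTranspose_mul]
      rw [hT', Matrix.mul_assoc, Matrix.mul_assoc, ← Matrix.mul_assoc Sᴴ, this, Matrix.mul_zero]
    have h3 : M * T = 0 := by
      refine Matrix.ext_of_mulVec_single fun j => ?_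
      generalize (Pi.single j 1 : q → ℂ) = x
      rw [Matrix.zero_mulVec, ← Matrix.mulVec_mulVec, ← hM.dotProduct_mulVec_zero_iff,
        Matrix.star_mulVec, ← Matrix.dotProduct_mulVec, Matrix.mulVec_mulVec, Matrix.mulVec_mulVec,
        h2, Matrix.zero_mulVec, dotProduct_zero]
    rw [← sub_eq_zero, h1, h3]
  have hker : ∀ x, C *ᵥ x = 0 → D *ᵥ x = M *ᵥ x := by
    intro x hx
    rw [← hSx x hx, Matrix.mulVec_mulVec, Matrix.mulVec_mulVec, hDS]
  have hdiff : (D - M) * (G * C) = D - M := mul_eq_self_of_ker_le hG fun x hx => by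
    rw [Matrix.sub_mulVec, hker x hx, sub_self]
  have hdiff' : (G * C)ᴴ * (D - M) = D - M := by
    have := congrArg Matrix.conjTranspose hdiff
    rwa [Matrix.conjTranspose_mul, Matrix.conjTranspose_sub, hDp.1, hM.1] at this
  have hF : M + Cᴴ * (Gᴴ * (D - M) * G) * C = D := by
    have : Cᴴ * (Gᴴ * (D - M) * G) * C = D - M := by
      calc Cᴴ * (Gᴴ * (D - M) * G) * C = (G * C)ᴴ * (D - M) * (G * C) := by
            rw [Matrix.conjTranspose_mul]; simp only [Matrix.mul_assoc]
        _ = D - M := by rw [hdiff', hdiff]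
    rw [this, add_sub_cancel]
  refine ⟨Gᴴ * (D - M) * G, ?_, ?_⟩
  · rw [hF]; exact hDp
  · rw [hF]
    apply le_antisymm
    · rintro _ ⟨x, rfl⟩
      refine ⟨S *ᵥ (Y *ᵥ (Sᴴ *ᵥ (M *ᵥ x))), ?_, ?_⟩
      · rw [SetLike.mem_coe, LinearMap.mem_ker, Matrix.mulVecLin_apply, Matrix.mulVec_mulVec, hCS,
          Matrix.zero_mulVec]
      · simp only [Matrix.mulVecLin_apply, Matrix.mulVec_mulVec, hD, Matrix.mul_assoc]
    · rintro _ ⟨x, hx, rfl⟩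
      exact ⟨x, hker x hx⟩

/-- Hermitian output feedback can make a positive semidefinite matrix have any admissible rank
while its range avoids a given subspace. -/
theorem exists_posSemidef_rank_eq {M : Matrix q q ℂ} (hM : M.PosSemidef) (C : Matrix p q ℂ)
    (L : Submodule ℂ (q → ℂ))
    (hL : L ≤ LinearMap.range M.mulVecLin ⊔ LinearMap.range Cᴴ.mulVecLin)
    (hML : ∀ z, C *ᵥ z = 0 → M *ᵥ z ∈ L → M *ᵥ z = 0) (r : ℕ)
    (h₁ : Module.finrank ℂ
        ↥(LinearMap.range M.mulVecLin ⊔ LinearMap.range Cᴴ.mulVecLin) ≤ r + C.rank)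
    (h₂ : r + Module.finrank ℂ L ≤ Module.finrank ℂ
        ↥(LinearMap.range M.mulVecLin ⊔ LinearMap.range Cᴴ.mulVecLin)) :
    ∃ F : Matrix p p ℂ, (M + Cᴴ * F * C).PosSemidef ∧ (M + Cᴴ * F * C).rank = r ∧
      Disjoint (LinearMap.range (M + Cᴴ * F * C).mulVecLin) L := by
  obtain ⟨F, hFp, hFr⟩ := exists_posSemidef_range_eq_map_ker hM C
  set Z := (LinearMap.ker C.mulVecLin).map M.mulVecLin with hZ
  set R := LinearMap.range Cᴴ.mulVecLin with hR
  have hRrank : Module.finrank ℂ R = C.rank := by rw [← Matrix.rank_conjTranspose C, Matrix.rank]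
  have hFC : ∀ x, (Cᴴ * F * C) *ᵥ x ∈ R := fun x =>
    ⟨(F * C) *ᵥ x, by rw [Matrix.mulVecLin_apply, Matrix.mulVec_mulVec, Matrix.mul_assoc]⟩
  have hZR : Z ⊔ R = LinearMap.range M.mulVecLin ⊔ R := by
    apply le_antisymm
    · exact sup_le_sup_right LinearMap.map_le_range _
    · refine sup_le ?_ le_sup_right
      rintro _ ⟨x, rfl⟩
      have : M.mulVecLin x = (M + Cᴴ * F * C) *ᵥ x - (Cᴴ * F * C) *ᵥ x := by
        rw [Matrix.add_mulVec, add_sub_cancel_right, Matrix.mulVecLin_apply]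
      rw [this]
      refine Submodule.sub_mem _ (Submodule.mem_sup_left ?_) (Submodule.mem_sup_right (hFC x))
      rw [← hFr]
      exact ⟨x, rfl⟩
  rw [← hZR] at hL h₁ h₂
  -- If Mz = Cᴴu with Cz = 0, then zᴴMz = (Cz)ᴴu = 0, so Mz = 0.
  have hdZR : Disjoint Z R := by
    rw [Submodule.disjoint_def]
    rintro _ ⟨z, hz, rfl⟩ ⟨u, hu⟩
    have hz' : C *ᵥ z = 0 := hz
    rw [Matrix.mulVecLin_apply] at hu ⊢
    rw [← hM.dotProduct_mulVec_zero_iff]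
    change Cᴴ *ᵥ u = M *ᵥ z at hu
    rw [← hu, Matrix.dotProduct_mulVec, ← Matrix.star_mulVec, hz', star_zero, zero_dotProduct]
  have hdZL : Disjoint Z L := by
    rw [Submodule.disjoint_def]
    rintro _ ⟨z, hz, rfl⟩ h
    exact hML z hz h
  have e1 := Submodule.finrank_sup_add_finrank_inf_eq Z R
  have e2 := Submodule.finrank_sup_add_finrank_inf_eq Z L
  have e3 := Submodule.finrank_sup_add_finrank_inf_eq (Z ⊔ L) R
  rw [hdZR.eq_bot, finrank_bot] at e1
  rw [hdZL.eq_bot, finrank_bot] at e2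
  rw [show Z ⊔ L ⊔ R = Z ⊔ R from le_antisymm
    (sup_le (sup_le le_sup_left hL) le_sup_right) (sup_le_sup_right le_sup_left _)] at e3
  -- R' collects directions of R independent of Z + L. Its dimension is dim(Z + R) - dim Z - dim L,
  -- so the upper bound on r leaves room for T.
  obtain ⟨R', hR'd, hR's⟩ : ∃ R' : Submodule ℂ (q → ℂ), ((Z ⊔ L) ⊓ R) ⊓ R' = ⊥ ∧
      ((Z ⊔ L) ⊓ R) ⊔ R' = R := by
    obtain ⟨T, hT⟩ := Submodule.exists_isCompl ((Z ⊔ L) ⊓ R)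
    refine ⟨T ⊓ R, ?_, ?_⟩
    · rw [← inf_assoc, hT.inf_eq_bot, bot_inf_eq]
    · rw [← sup_inf_assoc_of_le T inf_le_right, hT.sup_eq_top, top_inf_eq]
  have e4 := Submodule.finrank_sup_add_finrank_inf_eq ((Z ⊔ L) ⊓ R) R'
  rw [hR's, hR'd, finrank_bot] at e4
  -- The natural subtraction does not truncate: `h₁` and dim(Z + R) = dim Z + rank C give dim Z ≤ r.
  obtain ⟨T, hTR', hTd⟩ := exists_le_finrank_eq R' (d := r - Module.finrank ℂ Z) (by omega)
  have hTR : T ≤ R := hTR'.trans (hR's ▸ le_sup_right)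
  obtain ⟨Y, hY⟩ := exists_matrix_range_eq T
  obtain ⟨G, hG⟩ := exists_generalized_inverse Cᴴ
  have hCY : Cᴴ * (G * Y) = Y := by
    refine Matrix.ext_of_mulVec_single fun j => ?_
    generalize (Pi.single j 1 : q → ℂ) = x
    obtain ⟨u, hu⟩ := hTR (hY ▸ ⟨x, rfl⟩ : Y *ᵥ x ∈ T)
    rw [Matrix.mulVecLin_apply] at hu
    rw [← Matrix.mul_assoc, ← Matrix.mulVec_mulVec, ← hu, Matrix.mulVec_mulVec, hG]
  -- Since T lies in range Cᴴ, the positive semidefinite update YYᴴ with range T is realizable as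
  -- output feedback.
  have hYY : Cᴴ * ((G * Y) * (G * Y)ᴴ) * C = Y * Yᴴ := by
    have h := congrArg Matrix.conjTranspose hCY
    rw [Matrix.conjTranspose_mul, Matrix.conjTranspose_conjTranspose] at h
    rw [← Matrix.mul_assoc, hCY, Matrix.mul_assoc, h]
  have hYr : LinearMap.range (Y * Yᴴ).mulVecLin = T := by
    rw [← hY]
    apply Submodule.eq_of_le_of_finrank_eq
    · rintro _ ⟨x, rfl⟩
      exact ⟨Yᴴ *ᵥ x, by simp only [Matrix.mulVecLin_apply, Matrix.mulVec_mulVec]⟩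
    · exact Matrix.rank_self_mul_conjTranspose Y
  have hsum : M + Cᴴ * (F + (G * Y) * (G * Y)ᴴ) * C = (M + Cᴴ * F * C) + Y * Yᴴ := by
    rw [← hYY, Matrix.mul_add, Matrix.add_mul, add_assoc]
  have hYp := Matrix.posSemidef_self_mul_conjTranspose Y
  have hrange : LinearMap.range (M + Cᴴ * (F + (G * Y) * (G * Y)ᴴ) * C).mulVecLin = Z ⊔ T := by
    rw [hsum, range_add_of_posSemidef hFp hYp, hFr, hYr]
  refine ⟨F + (G * Y) * (G * Y)ᴴ, ?_, ?_, ?_⟩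
  · rw [hsum]; exact hFp.add hYp
  · have e5 := Submodule.finrank_sup_add_finrank_inf_eq Z T
    rw [(hdZR.mono_right hTR).eq_bot, finrank_bot] at e5
    rw [Matrix.rank, hrange]
    omega
  · rw [hrange, Submodule.disjoint_def]
    intro x hx hxL
    obtain ⟨z, hz, t, ht, rfl⟩ := Submodule.mem_sup.1 hx
    have ht0 : t = 0 := by
      have : t ∈ ((Z ⊔ L) ⊓ R) ⊓ R' := by
        refine ⟨⟨?_, hTR ht⟩, hTR' ht⟩
        rw [← add_sub_cancel_left z t]
        exact Submodule.sub_mem _ (Submodule.mem_sup_right hxL) (Submodule.mem_sup_left hz)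
      rwa [hR'd, Submodule.mem_bot] at this
    rw [ht0, add_zero] at hxL ⊢
    exact (Submodule.disjoint_def.1 hdZL) z hz hxL

end OutputInjection

/-! ### Subspace forms of the rank conditions and of the pH structure. -/

section Conditions

variable {n m k l : ℕ} {E A Q : Matrix (Fin n) (Fin n) ℂ} {B : Matrix (Fin n) (Fin m) ℂ}
  {C : Matrix (Fin m) (Fin n) ℂ} {Ta : Matrix (Fin n) (Fin k) ℂ} {Sb : Matrix (Fin n) (Fin l) ℂ}

theorem IsTa.conjTranspose_mulVec_eq_zero_iff (hTa : IsTa E C Ta) (w : Fin n → ℂ) :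
    Taᴴ *ᵥ w = 0 ↔ ∃ z, C *ᵥ z = 0 ∧ E *ᵥ z = w := by
  obtain ⟨j, S, hS, hT⟩ := hTa
  rw [hT.conjTranspose_mulVec_eq_zero_iff]
  constructor
  · rintro ⟨z, rfl⟩
    exact ⟨S *ᵥ z, (hS.2 _).2 ⟨z, rfl⟩, by rw [Matrix.mulVec_mulVec]⟩
  · rintro ⟨z, hz, rfl⟩
    obtain ⟨c, rfl⟩ := (hS.2 z).1 hz
    exact ⟨c, by rw [Matrix.mulVec_mulVec]⟩

theorem IsRightNullBasis.injective {p q : Type*} [Fintype p] [Fintype q] {M : Matrix p q ℂ}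
    {S : Matrix q (Fin k) ℂ} (hS : IsRightNullBasis M S) {x : Fin k → ℂ} (hx : S *ᵥ x = 0) :
    x = 0 := by
  rw [← Matrix.one_mulVec x, ← hS.1, ← Matrix.mulVec_mulVec, hx, Matrix.mulVec_zero]

theorem IsSb.injective (hSb : IsSb E A B C Sb) {x : Fin l → ℂ} (hx : Sb *ᵥ x = 0) : x = 0 := by
  obtain ⟨j, T, hT, hS⟩ := hSb
  exact hS.injective hx

theorem IsSb.mem_range_iff (hSb : IsSb E A B C Sb) (x : Fin n → ℂ) :
    (∃ c, Sb *ᵥ c = x) ↔ E *ᵥ x = 0 ∧ C *ᵥ x = 0 ∧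
      A *ᵥ x ∈ LinearMap.range E.mulVecLin ⊔ LinearMap.range B.mulVecLin := by
  obtain ⟨j, T, hT, hS⟩ := hSb
  have h := hS.2 x
  rw [Matrix.fromRows_mulVec, Matrix.fromRows_mulVec] at h
  have hz : ∀ {a b : Type} (u : a → ℂ) (v : b → ℂ), Sum.elim u v = 0 ↔ u = 0 ∧ v = 0 := by
    intro a b u v
    constructor
    · intro h
      exact ⟨funext fun i => congrFun h (Sum.inl i), funext fun i => congrFun h (Sum.inr i)⟩
    · rintro ⟨rfl, rfl⟩
      exact Sum.elim_zero_zero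
  rw [hz, hz, ← Matrix.mulVec_mulVec, hT.conjTranspose_mulVec_eq_zero_iff] at h
  rw [← range_fromCols]
  simp only [LinearMap.mem_range, Matrix.mulVecLin_apply]
  simp only [eq_comm (a := x)] at h
  rw [← h]
  tauto

/-- The kernel of Taᴴ is E(ker C), so the rank condition is impulse-freeness restricted to ker C.
The requirement Ax ∈ range [E B] built into Sb is automatic when Ax = Ez. -/
theorem rank_eq_iff (hTa : IsTa E C Ta) (hSb : IsSb E A B C Sb) :
    (Taᴴ * A * Sb).rank = l ↔
      ∀ x z, E *ᵥ x = 0 → C *ᵥ x = 0 → C *ᵥ z = 0 → A *ᵥ x = E *ᵥ z → x = 0 := by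
  have h := rank_eq_card_iff (Taᴴ * A * Sb)
  rw [Fintype.card_fin] at h
  rw [h]
  constructor
  · intro h x z hE hC hz hA
    obtain ⟨c, rfl⟩ := (hSb.mem_range_iff x).2
      ⟨hE, hC, Submodule.mem_sup_left ⟨z, by rw [Matrix.mulVecLin_apply, hA]⟩⟩
    rw [h c, Matrix.mulVec_zero]
    rw [← Matrix.mulVec_mulVec, ← Matrix.mulVec_mulVec, hTa.conjTranspose_mulVec_eq_zero_iff]
    exact ⟨z, hz, hA.symm⟩
  · intro h c hc
    rw [← Matrix.mulVec_mulVec, ← Matrix.mulVec_mulVec, hTa.conjTranspose_mulVec_eq_zero_iff] at hc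
    obtain ⟨z, hz, hA⟩ := hc
    obtain ⟨hE, hC, -⟩ := (hSb.mem_range_iff _).1 ⟨c, rfl⟩
    exact hSb.injective (h _ z hE hC hz hA.symm)

theorem rank_fromRows_eq_iff (M : Matrix (Fin n) (Fin n) ℂ) :
    (Matrix.fromRows M C).rank = n ↔ ∀ x, M *ᵥ x = 0 → C *ᵥ x = 0 → x = 0 := by
  have h := rank_eq_card_iff (Matrix.fromRows M C)
  rw [Fintype.card_fin] at h
  rw [h]
  refine forall_congr' fun x => ?_
  rw [Matrix.fromRows_mulVec]
  constructor
  · intro h h1 h2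
    rw [h1, h2] at h
    exact h Sum.elim_zero_zero
  · intro h h'
    exact h (funext fun i => congrFun h' (Sum.inl i)) (funext fun i => congrFun h' (Sum.inr i))

/-- This eliminates J, R, G, P: QᴴP = 0 makes C equal to both GᴴQ and BᴴQ, and the Hermitian part of
QᴴA is -QᴴRQ. -/
theorem IsPortHamiltonianWith.properties (h : IsPortHamiltonianWith Q E A B C) :
    (∃ X, A = X * Q) ∧ C = Bᴴ * Q ∧ (Qᴴ * E).PosSemidef ∧ (-(Qᴴ * A + Aᴴ * Q)).PosSemidef := by
  obtain ⟨J, R, G, P, hA, hB, hC, -, hE, hJ, hR, hP⟩ := h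
  refine ⟨⟨_, hA⟩, ?_, hE, ?_⟩
  · have hP' : Pᴴ * Q = 0 := by
      have := congrArg Matrix.conjTranspose hP
      simpa using this
    rw [hC, hB, Matrix.conjTranspose_add, Matrix.conjTranspose_sub, Matrix.add_mul, Matrix.sub_mul,
      hP', add_zero, sub_zero]
  · have h1 : Qᴴ * A = Qᴴ * J * Q - Qᴴ * R * Q := by
      rw [hA, Matrix.sub_mul, Matrix.mul_sub, Matrix.mul_assoc, Matrix.mul_assoc]
    have h2 : Aᴴ * Q = (Qᴴ * A)ᴴ := by
      rw [Matrix.conjTranspose_mul, Matrix.conjTranspose_conjTranspose]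
    have h3 : -(Qᴴ * A + Aᴴ * Q) = Qᴴ * R * Q + Qᴴ * R * Q := by
      rw [h2, h1, Matrix.conjTranspose_sub, hR.1.eq]
      nth_rw 1 [hJ]
      abel
    rw [h3]
    exact hR.add hR

/-- Conversely, take P = 0, G = B, and for J and -R the skew-Hermitian and Hermitian parts of X. -/
theorem isPortHamiltonianWith_of_properties (hA : ∃ X, A = X * Q) (hC : C = Bᴴ * Q)
    (hE : (Qᴴ * E).PosSemidef) (hD : (-(Qᴴ * A + Aᴴ * Q)).PosSemidef) :
    IsPortHamiltonianWith Q E A B C := by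
  obtain ⟨X, rfl⟩ := hA
  refine ⟨(1 / 2 : ℂ) • (X - Xᴴ), (-(1 / 2) : ℂ) • (X + Xᴴ), B, 0, ?_, by simp, by simpa using hC,
    ?_, hE, ?_, ?_, by simp⟩
  · congr 1
    ext i j
    simp only [Matrix.sub_apply, Matrix.smul_apply, Matrix.add_apply, smul_eq_mul]
    ring
  · have := hE.1.eq
    rw [Matrix.conjTranspose_mul, Matrix.conjTranspose_conjTranspose] at this
    exact this.symm
  · rw [Matrix.conjTranspose_mul, Matrix.conjTranspose_mul, Matrix.conjTranspose_conjTranspose,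
      ← Matrix.mul_assoc, ← Matrix.neg_mul, ← Matrix.mul_neg]
    congr 2
    ext i j
    simp
    ring
  · have : Qᴴ * ((-(1 / 2) : ℂ) • (X + Xᴴ)) * Q =
        (1 / 2 : ℂ) • (-(Qᴴ * (X * Q) + (X * Q)ᴴ * Q)) := by
      rw [Matrix.conjTranspose_mul, Matrix.mul_smul, Matrix.smul_mul, Matrix.mul_add,
        Matrix.add_mul, Matrix.mul_assoc Qᴴ X Q, smul_neg, neg_smul]
    rw [this]
    refine hD.smul ?_
    rw [Complex.le_def]
    norm_num

end Conditions

/-! ### Necessity and sufficiency for output feedback. -/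

section Feedback

variable {n m k l : ℕ} {E A Q : Matrix (Fin n) (Fin n) ℂ} {B : Matrix (Fin n) (Fin m) ℂ}
  {C : Matrix (Fin m) (Fin n) ℂ} {Ta : Matrix (Fin n) (Fin k) ℂ} {Sb : Matrix (Fin n) (Fin l) ℂ}
  {K F : Matrix (Fin m) (Fin m) ℂ}

theorem add_feedback_mulVec (x : Fin n → ℂ) :
    (E + B * F * C) *ᵥ x = E *ᵥ x + B *ᵥ (F *ᵥ (C *ᵥ x)) := by
  simp only [Matrix.add_mulVec, Matrix.mulVec_mulVec, Matrix.mul_assoc]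

theorem sub_feedback_mulVec (x : Fin n → ℂ) :
    (A - B * K * C) *ᵥ x = A *ᵥ x - B *ᵥ (K *ᵥ (C *ᵥ x)) := by
  simp only [Matrix.sub_mulVec, Matrix.mulVec_mulVec, Matrix.mul_assoc]

theorem range_add_feedback_sup :
    LinearMap.range (E + B * F * C).mulVecLin ⊔ LinearMap.range B.mulVecLin =
      LinearMap.range E.mulVecLin ⊔ LinearMap.range B.mulVecLin := by
  have hB : ∀ v, B *ᵥ v ∈ LinearMap.range B.mulVecLin := fun v => ⟨v, rfl⟩
  apply le_antisymm <;> refine sup_le ?_ le_sup_right <;> rintro _ ⟨x, rfl⟩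
  · rw [Matrix.mulVecLin_apply, add_feedback_mulVec]
    exact Submodule.add_mem_sup ⟨x, rfl⟩ (hB _)
  · rw [Matrix.mulVecLin_apply, ← add_sub_cancel_right (E *ᵥ x) (B *ᵥ (F *ᵥ (C *ᵥ x))),
      ← add_feedback_mulVec]
    exact Submodule.sub_mem _ (Submodule.mem_sup_left ⟨x, rfl⟩) (Submodule.mem_sup_right (hB _))

theorem IsAsymptoticallyStable.isUnit_det (h : IsAsymptoticallyStable E A) : IsUnit A.det := by
  rw [isUnit_iff_ne_zero]
  intro h0
  have : (0 : ℂ) ∈ finiteSpectrum E A := by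
    change ((0 : ℂ) • E - A).det = 0
    rw [zero_smul, zero_sub, Matrix.det_neg, h0, mul_zero]
  simpa using h this

theorem solvabilityConditions_of_feedback (hTa : IsTa E C Ta) (hSb : IsSb E A B C Sb) {r : ℤ}
    (himp : IsImpulseFree (E + B * F * C) (A - B * K * C))
    (hstab : IsAsymptoticallyStable (E + B * F * C) (A - B * K * C))
    (hr : ((E + B * F * C).rank : ℤ) = r) : SolvabilityConditions E A B C Ta Sb r := by
  have hunit := hstab.isUnit_det
  rw [isImpulseFree_iff hunit] at himp
  have hi : (Taᴴ * A * Sb).rank = l := by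
    rw [rank_eq_iff hTa hSb]
    intro x z hE hC hz hA
    refine himp x z ?_ ?_
    · rw [add_feedback_mulVec, hE, hC]; simp
    · rw [add_feedback_mulVec, sub_feedback_mulVec, hC, hz, hA]; simp
  refine ⟨hi, ?_, ?_, ?_⟩
  · intro s hs
    have hs' : IsUnit (s • (E + B * F * C) - (A - B * K * C)).det := by
      rw [isUnit_iff_ne_zero]
      intro h0
      exact absurd (hstab h0) (by simp [hs])
    have hx : ∀ x, (s • (E + B * F * C) - (A - B * K * C)) *ᵥ x =
        (s • E - A) *ᵥ x + B *ᵥ ((s • F + K) *ᵥ (C *ᵥ x)) := by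
      intro x
      simp only [Matrix.sub_mulVec, Matrix.add_mulVec, Matrix.smul_mulVec, Matrix.mulVec_mulVec,
        Matrix.add_mul, Matrix.smul_mul, Matrix.mul_assoc, Matrix.mulVec_add, Matrix.mulVec_smul,
        smul_add]
      abel
    constructor
    · rw [rank_fromCols, show LinearMap.range (s • E - A).mulVecLin ⊔ LinearMap.range B.mulVecLin
        = ⊤ from ?_, finrank_top, Module.finrank_fintype_fun_eq_card, Fintype.card_fin]
      rw [eq_top_iff]
      intro v _
      have hv : v = (s • (E + B * F * C) - (A - B * K * C)) *ᵥ
          ((s • (E + B * F * C) - (A - B * K * C))⁻¹ *ᵥ v) := by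
        rw [Matrix.mulVec_mulVec, Matrix.mul_nonsing_inv _ hs', Matrix.one_mulVec]
      rw [hv, hx]
      exact Submodule.add_mem_sup ⟨_, rfl⟩ ⟨_, rfl⟩
    · rw [rank_fromRows_eq_iff]
      intro x h1 h2
      refine Matrix.eq_zero_of_mulVec_eq_zero hs'.ne_zero ?_
      rw [hx, h1, h2]
      simp
  · have := Submodule.finrank_add_le_finrank_add_finrank
      (LinearMap.range (E + B * F * C).mulVecLin) (LinearMap.range B.mulVecLin)
    rw [range_add_feedback_sup, ← rank_fromCols] at this
    change _ ≤ (E + B * F * C).rank + B.rank at this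
    omega
  · rw [hi]
    set L := LinearMap.range ((A - B * K * C) * Sb).mulVecLin with hL
    have hSbA : ∀ c, A *ᵥ (Sb *ᵥ c) = (A - B * K * C) *ᵥ (Sb *ᵥ c) := by
      intro c
      rw [sub_feedback_mulVec, ((hSb.mem_range_iff _).1 ⟨c, rfl⟩).2.1]
      simp
    have hLrank : Module.finrank ℂ L = l := by
      rw [hL]
      have h := rank_eq_card_iff ((A - B * K * C) * Sb)
      rw [Fintype.card_fin] at h
      refine h.2 fun c hc => hSb.injective (Matrix.eq_zero_of_mulVec_eq_zero hunit.ne_zero ?_)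
      rwa [Matrix.mulVec_mulVec]
    have hLle : L ≤ LinearMap.range E.mulVecLin ⊔ LinearMap.range B.mulVecLin := by
      rintro _ ⟨c, rfl⟩
      rw [Matrix.mulVecLin_apply, ← Matrix.mulVec_mulVec, ← hSbA]
      exact ((hSb.mem_range_iff _).1 ⟨c, rfl⟩).2.2
    -- Vectors of range Sb lie in ker E', so a common element A'x = E'z is excluded by
    -- impulse-freeness.
    have hdisj : LinearMap.range (E + B * F * C).mulVecLin ⊓ L = ⊥ := by
      rw [eq_bot_iff]
      rintro _ ⟨⟨z, hz⟩, ⟨c, rfl⟩⟩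
      obtain ⟨hE, hC, -⟩ := (hSb.mem_range_iff _).1 ⟨c, rfl⟩
      simp only [Matrix.mulVecLin_apply, ← Matrix.mulVec_mulVec] at hz ⊢
      rw [himp (Sb *ᵥ c) z (by rw [add_feedback_mulVec, hE, hC]; simp) hz.symm]
      simp
    have h1 := Submodule.finrank_sup_add_finrank_inf_eq
      (LinearMap.range (E + B * F * C).mulVecLin) L
    rw [hdisj, finrank_bot, hLrank] at h1
    have h2 := Submodule.finrank_mono (sup_le
      (le_sup_left.trans (range_add_feedback_sup (E := E) (B := B) (C := C) (F := F)).le) hLle)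
    rw [← rank_fromCols E B] at h2
    change _ = (E + B * F * C).rank + l at h1
    omega

theorem range_mul_sup (U : Matrix (Fin n) (Fin n) ℂ) :
    LinearMap.range (U * E).mulVecLin ⊔ LinearMap.range (U * B).mulVecLin =
      (LinearMap.range E.mulVecLin ⊔ LinearMap.range B.mulVecLin).map U.mulVecLin := by
  rw [Matrix.mulVecLin_mul, Matrix.mulVecLin_mul, LinearMap.range_comp, LinearMap.range_comp,
    Submodule.map_sup]

theorem exists_feedback (hpH : IsPortHamiltonianWith Q E A B C) (hTa : IsTa E C Ta)
    (hSb : IsSb E A B C Sb) {r : ℤ} (hcond : SolvabilityConditions E A B C Ta Sb r) :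
    ∃ K F : Matrix (Fin m) (Fin m) ℂ,
      IsRegular (E + B * F * C) (A - B * K * C) ∧
      IsImpulseFree (E + B * F * C) (A - B * K * C) ∧
      IsAsymptoticallyStable (E + B * F * C) (A - B * K * C) ∧
      ((E + B * F * C).rank : ℤ) = r ∧
      IsPortHamiltonianWith Q (E + B * F * C) (A - B * K * C) B C := by
  obtain ⟨hi, hii, hlow, hupp⟩ := hcond
  obtain ⟨⟨X, hX⟩, hC, hM, hD⟩ := hpH.properties
  rw [hi] at hupp
  rw [rank_eq_iff hTa hSb] at hi
  have hobs : ∀ s : ℂ, s.re = 0 → ∀ x, A *ᵥ x = s • E *ᵥ x → C *ᵥ x = 0 → x = 0 := by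
    intro s hs x hx hx'
    refine (rank_fromRows_eq_iff _).1 (hii s hs).2 x ?_ hx'
    rw [Matrix.sub_mulVec, Matrix.smul_mulVec, hx, sub_self]
  have hobs0 : ∀ x, A *ᵥ x = 0 → C *ᵥ x = 0 → x = 0 := fun x h1 h2 =>
    hobs 0 (by simp) x (by rw [h1, zero_smul]) h2
  -- Both A = XQ and C = BᴴQ vanish on ker Q, which contradicts (ii) at s = 0 unless Q is injective.
  have hQ : IsUnit Q.det := by
    rw [isUnit_iff_ne_zero]
    intro h0
    obtain ⟨v, hv, hQv⟩ := Matrix.exists_mulVec_eq_zero_iff.2 h0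
    refine hv (hobs0 v ?_ ?_)
    · rw [hX, ← Matrix.mulVec_mulVec, hQv, Matrix.mulVec_zero]
    · rw [hC, ← Matrix.mulVec_mulVec, hQv, Matrix.mulVec_zero]
  have hQH : IsUnit Qᴴ.det := by rw [Matrix.det_conjTranspose]; exact hQ.star
  have hQinj : ∀ x, Qᴴ *ᵥ x = 0 → x = 0 := fun x =>
    Matrix.eq_zero_of_mulVec_eq_zero hQH.ne_zero
  have hCH : Cᴴ = Qᴴ * B := by
    rw [hC, Matrix.conjTranspose_mul, Matrix.conjTranspose_conjTranspose]
  have hCrank : C.rank = B.rank := by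
    rw [← Matrix.rank_conjTranspose C, hCH, Matrix.rank_mul_eq_right_of_isUnit_det _ _ hQH]
  have hW : Module.finrank ℂ
      ↥(LinearMap.range (Qᴴ * E).mulVecLin ⊔ LinearMap.range Cᴴ.mulVecLin) =
        (Matrix.fromCols E B).rank := by
    rw [hCH, range_mul_sup, rank_fromCols]
    exact (Submodule.equivMapOfInjective _ (LinearMap.ker_eq_bot.1
      (LinearMap.ker_eq_bot'.2 hQinj)) _).finrank_eq.symm
  have hSbinj : ∀ c, (Qᴴ * A * Sb) *ᵥ c = 0 → c = 0 := by
    intro c hc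
    rw [← Matrix.mulVec_mulVec, ← Matrix.mulVec_mulVec] at hc
    exact hSb.injective (hobs0 _ (hQinj _ hc) ((hSb.mem_range_iff _).1 ⟨c, rfl⟩).2.1)
  have hLrank : Module.finrank ℂ (LinearMap.range (Qᴴ * A * Sb).mulVecLin) = l := by
    have h := rank_eq_card_iff (Qᴴ * A * Sb)
    rw [Fintype.card_fin] at h
    exact h.2 hSbinj
  -- Makes the lower bound in (iii) nonnegative, so that r equals `r.toNat`.
  have hBrank : B.rank ≤ (Matrix.fromCols E B).rank := by
    rw [rank_fromCols, Matrix.rank]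
    exact Submodule.finrank_mono le_sup_right
  obtain ⟨F, hFp, hFr, hFd⟩ := exists_posSemidef_rank_eq hM C
    (LinearMap.range (Qᴴ * A * Sb).mulVecLin)
    (by
      rintro _ ⟨c, rfl⟩
      rw [hCH, range_mul_sup, Matrix.mulVecLin_apply, ← Matrix.mulVec_mulVec,
        ← Matrix.mulVec_mulVec]
      exact ⟨_, ((hSb.mem_range_iff _).1 ⟨c, rfl⟩).2.2, rfl⟩)
    (by
      rintro z hz ⟨c, hc⟩
      simp only [Matrix.mulVecLin_apply, ← Matrix.mulVec_mulVec] at hc ⊢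
      obtain ⟨hE0, hC0, -⟩ := (hSb.mem_range_iff _).1 ⟨c, rfl⟩
      have hAE : A *ᵥ (Sb *ᵥ c) = E *ᵥ z := by
        rw [← sub_eq_zero]
        refine hQinj _ ?_
        rw [Matrix.mulVec_sub, hc, sub_self]
      rw [← hAE, hi _ z hE0 hC0 hz hAE]
      simp)
    r.toNat (by rw [hW, hCrank]; omega) (by rw [hW, hLrank]; omega)
  obtain ⟨K, hK⟩ : ∃ K : Matrix (Fin m) (Fin m) ℂ, K = 1 := ⟨1, rfl⟩
  have hQE : Qᴴ * (E + B * F * C) = Qᴴ * E + Cᴴ * F * C := by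
    rw [hCH, Matrix.mul_add]; simp only [Matrix.mul_assoc]
  have hQA : Qᴴ * (A - B * K * C) = Qᴴ * A - Cᴴ * C := by
    rw [hCH, hK, Matrix.mul_one, Matrix.mul_sub, Matrix.mul_assoc]
  have hE'p : (Qᴴ * (E + B * F * C)).PosSemidef := hQE ▸ hFp
  have hE'r : (E + B * F * C).rank = r.toNat := by
    rw [← hFr, ← hQE, Matrix.rank_mul_eq_right_of_isUnit_det _ _ hQH]
  have hdiss : ∀ x : Fin n → ℂ, (star x ⬝ᵥ (Qᴴ * A) *ᵥ x).re ≤ 0 := by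
    intro x
    have h := hD.dotProduct_mulVec_nonneg x
    have h2 : star x ⬝ᵥ (Aᴴ * Q) *ᵥ x = star (star x ⬝ᵥ (Qᴴ * A) *ᵥ x) := by
      rw [show Aᴴ * Q = (Qᴴ * A)ᴴ by
          rw [Matrix.conjTranspose_mul, Matrix.conjTranspose_conjTranspose],
        Matrix.dotProduct_mulVec, ← Matrix.star_mulVec, Matrix.star_dotProduct]
    rw [Matrix.neg_mulVec, Matrix.add_mulVec, dotProduct_neg, dotProduct_add, h2,
      Complex.le_def] at h
    have h3 := h.1
    simp only [Complex.zero_re, Complex.neg_re, Complex.add_re, Complex.star_def,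
      Complex.conj_re] at h3
    linarith
  have hCnonneg : ∀ x : Fin n → ℂ, 0 ≤ star (C *ᵥ x) ⬝ᵥ C *ᵥ x := fun x =>
    dotProduct_star_self_nonneg _
  have hquad : ∀ x : Fin n → ℂ, star x ⬝ᵥ (Qᴴ * (A - B * K * C)) *ᵥ x =
      star x ⬝ᵥ (Qᴴ * A) *ᵥ x - star (C *ᵥ x) ⬝ᵥ C *ᵥ x := by
    intro x
    rw [hQA, Matrix.sub_mulVec, dotProduct_sub, Matrix.star_mulVec, ← Matrix.dotProduct_mulVec,
      Matrix.mulVec_mulVec]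
  -- The real part is at most -‖Cx‖²; if it is nonnegative, both vanish.
  have hCzero : ∀ x : Fin n → ℂ, 0 ≤ (star x ⬝ᵥ (Qᴴ * (A - B * K * C)) *ᵥ x).re →
      C *ᵥ x = 0 ∧ (star x ⬝ᵥ (Qᴴ * (A - B * K * C)) *ᵥ x).re = 0 := by
    intro x hx
    have h1 := hdiss x
    obtain ⟨h2, h3⟩ := Complex.le_def.1 (hCnonneg x)
    have h4 := hquad x
    have h5 := congrArg Complex.re h4
    rw [Complex.sub_re] at h5
    rw [Complex.zero_re] at h2
    refine ⟨?_, by linarith⟩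
    apply dotProduct_star_self_eq_zero.1
    apply Complex.ext
    · rw [Complex.zero_re]; linarith
    · exact h3.symm
  have hCx : ∀ x, C *ᵥ x = 0 → (A - B * K * C) *ᵥ x = A *ᵥ x ∧ (E + B * F * C) *ᵥ x = E *ᵥ x := by
    intro x hx
    rw [sub_feedback_mulVec, add_feedback_mulVec, hx]
    simp
  have hstab : IsAsymptoticallyStable (E + B * F * C) (A - B * K * C) := by
    intro s hs
    by_contra hre
    replace hre : 0 ≤ s.re := not_lt.1 hre
    obtain ⟨x, hx0, hx⟩ := Matrix.exists_mulVec_eq_zero_iff.2 hs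
    rw [Matrix.sub_mulVec, sub_eq_zero, Matrix.smul_mulVec] at hx
    have hnn := hE'p.dotProduct_mulVec_nonneg x
    have hq : star x ⬝ᵥ (Qᴴ * (A - B * K * C)) *ᵥ x =
        s * (star x ⬝ᵥ (Qᴴ * (E + B * F * C)) *ᵥ x) := by
      rw [← Matrix.mulVec_mulVec, ← hx, Matrix.mulVec_smul, dotProduct_smul, Matrix.mulVec_mulVec,
        smul_eq_mul]
    obtain ⟨h1, h2⟩ := Complex.le_def.1 hnn
    have hqre := congrArg Complex.re hq
    rw [Complex.mul_re, ← h2, Complex.zero_im, mul_zero, sub_zero] at hqre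
    obtain ⟨hC0, hq0⟩ := hCzero x (by rw [hqre]; exact mul_nonneg hre h1)
    obtain ⟨hA', hE'⟩ := hCx x hC0
    rw [hA', hE'] at hx
    rw [hq0] at hqre
    -- Either s is imaginary and (ii) applies at s, or E'x = 0, hence Ax = 0 and (ii) applies at 0.
    rcases mul_eq_zero.1 hqre.symm with h | h
    · exact hx0 (hobs s h x hx.symm hC0)
    · have hEx : (Qᴴ * (E + B * F * C)) *ᵥ x = 0 :=
        (hE'p.dotProduct_mulVec_zero_iff x).1 (Complex.ext h h2.symm)
      rw [← Matrix.mulVec_mulVec] at hEx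
      have := hQinj _ hEx
      rw [hE'] at this
      rw [this, smul_zero] at hx
      exact hx0 (hobs0 x hx.symm hC0)
  refine ⟨K, F, ⟨0, ?_⟩, ?_, hstab, by rw [hE'r]; omega, ?_⟩
  · rw [zero_smul, zero_sub, Matrix.det_neg]
    exact mul_ne_zero (pow_ne_zero _ (by norm_num)) hstab.isUnit_det.ne_zero
  · rw [isImpulseFree_iff hstab.isUnit_det]
    intro x z hx hz
    -- QᴴE' is Hermitian, so xᴴQᴴE'z = (QᴴE'x)ᴴz = 0.
    have hq : star x ⬝ᵥ (Qᴴ * (A - B * K * C)) *ᵥ x = 0 := by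
      rw [← Matrix.mulVec_mulVec, hz, Matrix.mulVec_mulVec, Matrix.dotProduct_mulVec, ← hE'p.1.eq,
        ← Matrix.star_mulVec, ← Matrix.mulVec_mulVec, hx]
      simp
    obtain ⟨hC0, -⟩ := hCzero x (by rw [hq, Complex.zero_re])
    obtain ⟨hA', hE'⟩ := hCx x hC0
    rw [hE'] at hx
    rw [hA'] at hz
    obtain ⟨c, rfl⟩ := (hSb.mem_range_iff x).2 ⟨hx, hC0, by
      rw [hz, ← range_add_feedback_sup (C := C) (F := F)]
      exact Submodule.mem_sup_left ⟨z, rfl⟩⟩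
    have h0 : (Qᴴ * A * Sb) *ᵥ c = 0 := by
      refine (Submodule.disjoint_def.1 hFd) _ ⟨z, ?_⟩ ⟨c, rfl⟩
      rw [← hQE, Matrix.mulVecLin_apply, ← Matrix.mulVec_mulVec, ← hz, Matrix.mulVec_mulVec,
        Matrix.mulVec_mulVec, Matrix.mul_assoc]
    rw [hSbinj c h0, Matrix.mulVec_zero]
  -- Since C = BᴴQ, the feedback term BC equals BBᴴQ and keeps the factor Q.
  · refine isPortHamiltonianWith_of_properties ⟨X - B * Bᴴ, ?_⟩ hC hE'p ?_
    · rw [hK, Matrix.sub_mul, ← hX, Matrix.mul_one, Matrix.mul_assoc, ← hC]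
    · have h : -(Qᴴ * (A - B * K * C) + (A - B * K * C)ᴴ * Q) =
          -(Qᴴ * A + Aᴴ * Q) + (Cᴴ * C + Cᴴ * C) := by
        have h' : (A - B * K * C)ᴴ * Q = Aᴴ * Q - Cᴴ * C := by
          rw [hK, Matrix.mul_one, Matrix.conjTranspose_sub, Matrix.conjTranspose_mul, Matrix.sub_mul,
            Matrix.mul_assoc Cᴴ, ← hC]
        rw [hQA, h']
        abel
      rw [h]
      have hCC := Matrix.posSemidef_conjTranspose_mul_self C
      exact hD.add (hCC.add hCC)

end Feedback

end DescriptorSystem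

theorem mainTheorem3 {n m k l : ℕ} (E A : Matrix (Fin n) (Fin n) ℂ)
    (B : Matrix (Fin n) (Fin m) ℂ) (C : Matrix (Fin m) (Fin n) ℂ)
    (hpH : DescriptorSystem.IsPortHamiltonian E A B C)
    (Ta : Matrix (Fin n) (Fin k) ℂ) (hTa : DescriptorSystem.IsTa E C Ta)
    (Sb : Matrix (Fin n) (Fin l) ℂ) (hSb : DescriptorSystem.IsSb E A B C Sb)
    (r : ℤ) :
    ((∃ K F : Matrix (Fin m) (Fin m) ℂ,
        DescriptorSystem.IsRegular (E + B * F * C) (A - B * K * C) ∧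
        DescriptorSystem.IsImpulseFree (E + B * F * C) (A - B * K * C) ∧
        DescriptorSystem.IsAsymptoticallyStable (E + B * F * C) (A - B * K * C) ∧
        ((E + B * F * C).rank : ℤ) = r ∧
        DescriptorSystem.IsPortHamiltonian (E + B * F * C) (A - B * K * C) B C) ↔
      DescriptorSystem.SolvabilityConditions E A B C Ta Sb r) ∧
    -- the same with the structure matrix `Q` of the given system kept in the closed loop
    (∀ Q : Matrix (Fin n) (Fin n) ℂ, DescriptorSystem.IsPortHamiltonianWith Q E A B C →
      ((∃ K F : Matrix (Fin m) (Fin m) ℂ,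
          DescriptorSystem.IsRegular (E + B * F * C) (A - B * K * C) ∧
          DescriptorSystem.IsImpulseFree (E + B * F * C) (A - B * K * C) ∧
          DescriptorSystem.IsAsymptoticallyStable (E + B * F * C) (A - B * K * C) ∧
          ((E + B * F * C).rank : ℤ) = r ∧
          DescriptorSystem.IsPortHamiltonianWith Q (E + B * F * C) (A - B * K * C) B C) ↔
        DescriptorSystem.SolvabilityConditions E A B C Ta Sb r)) := by
  refine ⟨⟨?_, ?_⟩, fun Q hQ => ⟨?_, DescriptorSystem.exists_feedback hQ hTa hSb⟩⟩
  · rintro ⟨K, F, -, himp, hstab, hr, -⟩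
    exact DescriptorSystem.solvabilityConditions_of_feedback hTa hSb himp hstab hr
  · intro hcond
    obtain ⟨Q, hQ⟩ := hpH
    obtain ⟨K, F, h1, h2, h3, h4, h5⟩ := DescriptorSystem.exists_feedback hQ hTa hSb hcond
    exact ⟨K, F, h1, h2, h3, h4, Q, h5⟩
  · rintro ⟨K, F, -, himp, hstab, hr, -⟩
    exact DescriptorSystem.solvabilityConditions_of_feedback hTa hSb himp hstab hr
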